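/- Let $K=K(\alpha,\beta)$ be a two-bridge knot in $S^3$, where $\alpha>1$ and $\beta$ are odd, relatively prime integers (every two-bridge knot is of this form), given by Schubert's normal form: the diagram with two bridges $x,y$ in which, with $\varepsilon_k=(-1)^{\lfloor k\beta/\alpha\rfloor}$, the underpass from $x$ to $y$ passes successively under $y,x,y,\dots,x$ and the underpass from $y$ to $x$ successively under $x,y,x,\dots,y$ ($\alpha-1$ undercrossings each), the $k$-th undercrossing of either one having sign $\varepsilon_k$. Let $M$ be the complement of an open tubular neighbourhood of $K$, with $\pi_1(M)$ given by the Wirtinger presentation of this diagram, let $\mu=x$ be the meridian and $\lambda$ the preferred (null-homologous) longitude commuting with it, and let $i_*\colon\pi_1(\partial M)=\mathbb Z\mu\oplus\mathbb Z\lambda\to\pi_1(M)$ be the homomorphism induced by inclusion. (Thus $\pi_1(M)=\langle x,y\mid xw=wy\rangle$ and $\lambda=x^{-2\sum_k\varepsilon_k}ww^*$ with $w=y^{\varepsilon_1}x^{\varepsilon_2}\cdots y^{\varepsilon_{\alpha-2}}x^{\varepsilon_{\alpha-1}}$ and $w^*=x^{\varepsilon_1}y^{\varepsilon_2}\cdots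 x^{\varepsilon_{\alpha-2}}y^{\varepsilon_{\alpha-1}}$.) For a group $\Gamma$ let $X(\Gamma)$ be the set of characters $\chi_\varrho(g)=\operatorname{tr}\varrho(g)$ of representations $\varrho\colon\Gamma\to SL(2,\mathbb C)$, with its Zariski topology; write $X(M)=X(\pi_1 M)$, $X(\partial M)=X(\pi_1\partial M)$, and let $r\colon X(M)\to X(\partial M)$ be restriction along $i_*$. For relatively prime integers $p,q$ (the case $p/q=1/0$ is included) the slope $p/q$, i.e. the slope of a simple closed curve $\gamma=p\mu+q\lambda$ on $\partial M$, is called irregular if there is an irreducible representation $\varrho\colon\pi_1(M)\to SL(2,\mathbb C)$ such that (i) $\chi_\varrho$ lies on a one-dimensional irreducible component $X_i$ of $X(M)$ for which $r(X_i)$ is one-dimensional; (ii) $\operatorname{tr}\varrho(a)=\pm2$ for every $a$ in the image of $i_*$; (iii) $\ker(\varrho\circ i_*)$ is the cyclic group generated by $\gamma$; and it is called regular otherwise. Then every slope $p/q$ of $K$ is regular. Moreover, for all relatively prime integers $p,q$, no irreducible representation $\varrho\colon\pi_1(M)\to SL(2,\mathbb C)$ with $\operatorname{tr}\varrho(\mu)=\pm2$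 satisfies $\varrho(\mu^p\lambda^q)=I$. -/

import Mathlib

/-!
### Knot diagrams and their Wirtinger groups

An oriented knot diagram with at least one undercrossing is recorded by its Wirtinger data.
Starting from a base point and following the orientation, the undercrossings are met in the order
`0, 1, …, n - 1`; the arcs of the diagram (maximal pieces between consecutive undercrossings) are
numbered so that arc `i` runs into undercrossing `i` and arc `i + 1` (mod `n`) leaves it.
-/

/-- The Wirtinger data of an oriented knot diagram: the number of crossings and, for the `i`-th
undercrossing, the arc that passes over it and the sign of the crossing. The knot group and its
peripheral elements depend on these data alone, so planarity of the diagram is not recorded. -/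
structure KnotDiagram where
  crossings : ℕ
  crossings_pos : 0 < crossings
  overArc : Fin crossings → Fin crossings
  sign : Fin crossings → ℤˣ

namespace KnotDiagram

/-- The arc (or undercrossing) number `j`, read cyclically. -/
def idx (D : KnotDiagram) (j : ℕ) : Fin D.crossings :=
  ⟨j % D.crossings, Nat.mod_lt j D.crossings_pos⟩

/-- The Wirtinger relators: at the `i`-th undercrossing, with over-arc `c` and sign `ε`,
`a_{i+1} = c^{-ε} a_i c^{ε}`. -/
def relators (D : KnotDiagram) : Set (FreeGroup (Fin D.crossings)) :=
  Set.range fun i : Fin D.crossings =>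
    (FreeGroup.of (D.overArc i) ^ (D.sign i : ℤ))⁻¹ * FreeGroup.of i *
      FreeGroup.of (D.overArc i) ^ (D.sign i : ℤ) * (FreeGroup.of (D.idx (i + 1)))⁻¹

/-- The knot group: the fundamental group of the knot complement, in its Wirtinger
presentation. -/
abbrev KnotGroup (D : KnotDiagram) : Type := PresentedGroup D.relators

/-- The meridian of the arc `i`. -/
def arc (D : KnotDiagram) (i : Fin D.crossings) : D.KnotGroup := PresentedGroup.of i

/-- The meridian at the base point (on arc `0`). -/
def meridian (D : KnotDiagram) : D.KnotGroup := D.arc (D.idx 0)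

/-- The contribution `c^{ε}` of the `j`-th undercrossing to a parallel of the knot. -/
def passage (D : KnotDiagram) (j : ℕ) : D.KnotGroup :=
  D.arc (D.overArc (D.idx j)) ^ (D.sign (D.idx j) : ℤ)

/-- The writhe: the sum of the signs of all crossings. -/
def writhe (D : KnotDiagram) : ℤ := ∑ i, (D.sign i : ℤ)

/-- The blackboard parallel of the knot: the product of the passages under all crossings. -/
def parallel (D : KnotDiagram) : D.KnotGroup := ((List.range D.crossings).map D.passage).prod

/-- The preferred longitude: the parallel, corrected by a power of the meridian so that it is
null-homologous in the knot complement. -/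
def longitude (D : KnotDiagram) : D.KnotGroup := D.meridian ^ (-D.writhe) * D.parallel

theorem arc_succ (D : KnotDiagram) (j : ℕ) :
    D.arc (D.idx (j + 1)) = (D.passage j)⁻¹ * D.arc (D.idx j) * D.passage j := by
  have h := PresentedGroup.one_of_mem (rels := D.relators) ⟨D.idx j, rfl⟩
  simp only [map_mul, map_inv, map_zpow] at h
  have h2 : D.idx ((D.idx j : ℕ) + 1) = D.idx (j + 1) := by
    simp [idx]
  rw [h2] at h
  exact (mul_inv_eq_one.mp h).symm

theorem arc_eq (D : KnotDiagram) (k : ℕ) :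
    ((List.range k).map D.passage).prod * D.arc (D.idx k) =
      D.meridian * ((List.range k).map D.passage).prod := by
  induction k with
  | zero => simp [meridian]
  | succ k ih =>
    rw [List.range_succ, List.map_append, List.prod_append, arc_succ]
    simp only [List.map_cons, List.map_nil, List.prod_cons, List.prod_nil, mul_one]
    rw [← mul_assoc D.meridian, ← ih]
    group

theorem commute_meridian_longitude (D : KnotDiagram) : Commute D.meridian D.longitude := by
  have h := D.arc_eq D.crossings
  have h2 : D.idx D.crossings = D.idx 0 := by simp [idx]
  rw [h2] at h
  have h3 : Commute D.meridian D.parallel := h.symm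
  exact ((Commute.refl _).zpow_right _).mul_right h3

/-- The homomorphism from `π₁(∂M) = H₁(∂M; ℤ) = ℤ ⊕ ℤ` to the knot group induced by the inclusion
of the boundary torus of the knot complement, in the basis (meridian, preferred longitude):
`(m, n) ↦ μ^m λ^n`. -/
def peripheral (D : KnotDiagram) : Multiplicative (ℤ × ℤ) →* D.KnotGroup where
  toFun g := D.meridian ^ g.toAdd.1 * D.longitude ^ g.toAdd.2
  map_one' := by simp
  map_mul' g h := by
    have hc := (D.commute_meridian_longitude.zpow_zpow h.toAdd.1 g.toAdd.2).eq
    simp only [toAdd_mul, Prod.fst_add, Prod.snd_add, zpow_add]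
    calc _ = D.meridian ^ g.toAdd.1 * (D.meridian ^ h.toAdd.1 * D.longitude ^ g.toAdd.2) *
          D.longitude ^ h.toAdd.2 := by simp only [mul_assoc]
      _ = _ := by rw [hc]; simp only [mul_assoc]

end KnotDiagram

/-!
### Two-bridge knots

Schubert's normal form of the two-bridge knot `K(α, β)` (`α > 1` and `β` odd and coprime) has two
bridges. Each of the two underpasses leaves the end of one bridge, has `α - 1` undercrossings which
pass alternately under the other bridge and under the bridge it has left, the `k`-th one with sign
`(-1)^⌊k β / α⌋`, and ends at the beginning of the other bridge. Numbering from the bridge `x`, the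
bridges are the arcs `0` (`x`) and `α - 1` (`y`), so the knot group is generated by
`x` and `y` and the first underpass gives `x w = w y` with
`w = y^{ε₁} x^{ε₂} ⋯ y^{ε_{α-2}} x^{ε_{α-1}}`; the second one gives `y w* = w* x` with
`w* = x^{ε₁} y^{ε₂} ⋯ x^{ε_{α-2}} y^{ε_{α-1}}`.
-/

/-- The sign `ε_k = (-1)^⌊k β / α⌋` (for `α > 0`, integer division by `α` is the floor). -/
def twoBridgeSign (α : ℕ) (β : ℤ) (k : ℕ) : ℤˣ :=
  (-1 : ℤˣ) ^ ((k * β : ℤ) / (α : ℤ))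

/-- Schubert's normal form of the two-bridge knot `K(α, β)`. -/
def twoBridgeKnot (α : ℕ) (β : ℤ) (hα : 1 < α) : KnotDiagram where
  crossings := 2 * (α - 1)
  crossings_pos := by omega
  overArc j :=
    -- the even-numbered undercrossings of an underpass (counting from `0`) lie below the other
    -- bridge, the odd-numbered ones below the bridge that the underpass has left
    if ((j : ℕ) < α - 1 ↔ Even (j : ℕ)) then ⟨α - 1, by omega⟩ else ⟨0, by omega⟩
  sign j := twoBridgeSign α β ((j : ℕ) % (α - 1) + 1)

/-!
### Representations, character varieties and regular slopes
-/

/-- `SL(2, ℂ)`. -/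
abbrev SL2C : Type := Matrix.SpecialLinearGroup (Fin 2) ℂ

/-- The character `g ↦ tr ρ(g)` of a representation. -/
def character {Γ : Type} [Group Γ] (ρ : Γ →* SL2C) (g : Γ) : ℂ :=
  Matrix.trace (ρ g : Matrix (Fin 2) (Fin 2) ℂ)

/-- The linear representation on `ℂ²` underlying a homomorphism to `SL(2, ℂ)`. -/
def linearRep {Γ : Type} [Group Γ] (ρ : Γ →* SL2C) : Representation ℂ Γ (Fin 2 → ℂ) where
  toFun g := Matrix.toLin' (ρ g : Matrix (Fin 2) (Fin 2) ℂ)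
  map_one' := by simp; rfl
  map_mul' g h := by simp [Matrix.toLin'_mul]; rfl

/-- A representation in `SL(2, ℂ)` is irreducible if the representation on `ℂ²` is. -/
def IsIrreducibleRep {Γ : Type} [Group Γ] (ρ : Γ →* SL2C) : Prop :=
  (linearRep ρ).IsIrreducible

/-- The character variety `X(Γ)`: the set of characters of representations `Γ → SL(2, ℂ)`. -/
def CharacterVariety (Γ : Type) [Group Γ] : Type :=
  {χ : Γ → ℂ // ∃ ρ : Γ →* SL2C, character ρ = χ}

/-- The Zariski topology of `X(Γ)`: the basic open sets are the non-vanishing loci of the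
polynomials in the coordinate functions `χ ↦ χ(g)`, `g ∈ Γ`. -/
instance (Γ : Type) [Group Γ] : TopologicalSpace (CharacterVariety Γ) :=
  TopologicalSpace.generateFrom
    {U | ∃ f : MvPolynomial Γ ℂ, U = {χ | MvPolynomial.eval χ.val f ≠ 0}}

/-- The point of `X(Γ)` given by a representation. -/
def CharacterVariety.mk {Γ : Type} [Group Γ] (ρ : Γ →* SL2C) : CharacterVariety Γ :=
  ⟨character ρ, ρ, rfl⟩

/-- The restriction map `X(Γ) → X(Λ)` induced by a homomorphism `Λ → Γ`. -/
def CharacterVariety.restrict {Γ Λ : Type} [Group Γ] [Group Λ] (i : Λ →* Γ)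
    (χ : CharacterVariety Γ) : CharacterVariety Λ :=
  ⟨fun g => χ.val (i g), by
    obtain ⟨ρ, hρ⟩ := χ.property
    exact ⟨ρ.comp i, by rw [← hρ]; rfl⟩⟩

/-- The slope of `γ ∈ π₁(∂M)` is irregular if there is an irreducible representation `ρ` of the
knot group such that (i) its character lies on a one-dimensional irreducible component of `X(M)`
whose image in `X(∂M)` is one-dimensional, (ii) `ρ` has trace `±2` on the image of `π₁(∂M)`, and
(iii) the kernel of the restriction of `ρ` to `π₁(∂M)` is the cyclic group generated by `γ`. -/
def KnotDiagram.IsIrregular (D : KnotDiagram) (γ : Multiplicative (ℤ × ℤ)) : Prop :=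
  ∃ ρ : D.KnotGroup →* SL2C, IsIrreducibleRep ρ ∧
    (∃ X ∈ irreducibleComponents (CharacterVariety D.KnotGroup),
      CharacterVariety.mk ρ ∈ X ∧ topologicalKrullDim X = 1 ∧
      topologicalKrullDim (CharacterVariety.restrict D.peripheral '' X) = 1) ∧
    (∀ a : Multiplicative (ℤ × ℤ),
      character ρ (D.peripheral a) = 2 ∨ character ρ (D.peripheral a) = -2) ∧
    (ρ.comp D.peripheral).ker = Subgroup.zpowers γ

/-- The slope `p/q` (with `p`, `q` coprime, `1/0` included), represented by the simple closed curve
`p μ + q λ`, is regular if it is not irregular. -/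
def KnotDiagram.IsRegularSlope (D : KnotDiagram) (p q : ℤ) : Prop :=
  ¬ D.IsIrregular (Multiplicative.ofAdd (p, q))

open Polynomial
open scoped Matrix

/-! This is Riley's argument on parabolic representations plus an integrality observation. Let `ρ`
be irreducible with tr ρ(μ) = 2s, s = ±1. The bridges x, y are conjugate and share no eigenvector,
so after conjugation x = s U(1) and y = s L(z), with U upper and L lower unipotent
(`exists_conj_eq_unipotent`). The word w becomes a matrix W = (a b; c d) whose entries are integral
polynomials in z. The relation xw = wy forces d(z) = 0, and d has leading coefficient ±1, so z is an
algebraic integer (`exists_polynomial_alternating_prod`).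

The signs are palindromic (`twoBridgeSign_sub`), so w* is w read backwards, and reversal swaps the
diagonal entries of W (`alternating_prod_reverse`). With d = 0 and bc = -1 the product ww* is
-U(-2ab), and λ is -U(2g) for an algebraic integer g (`map_longitude_eq`).

Thus μ^p λ^q goes to s^p (-1)^q U(p + 2gq). If this is I and q ≠ 0, then g is rational, hence an
integer; coprimality gives q = ±1 with p even, and the scalar is -1, a contradiction
(`smul_upperUnipotent_mul_ne_one`). -/

/-! ### Unipotent matrices -/

/-- The upper unipotent matrix with off-diagonal entry `t`. -/
def upperUnipotent (t : ℂ) : Matrix (Fin 2) (Fin 2) ℂ := !![1, t; 0, 1]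

/-- The lower unipotent matrix with off-diagonal entry `t`. -/
def lowerUnipotent (t : ℂ) : Matrix (Fin 2) (Fin 2) ℂ := !![1, 0; t, 1]

theorem upperUnipotent_mul (t u : ℂ) :
    upperUnipotent t * upperUnipotent u = upperUnipotent (t + u) := by
  simp [upperUnipotent, add_comm]

theorem lowerUnipotent_mul (t u : ℂ) :
    lowerUnipotent t * lowerUnipotent u = lowerUnipotent (t + u) := by
  simp [lowerUnipotent]

theorem upperUnipotent_zero : upperUnipotent 0 = 1 := by
  simp [upperUnipotent, Matrix.one_fin_two]

theorem lowerUnipotent_zero : lowerUnipotent 0 = 1 := by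
  simp [lowerUnipotent, Matrix.one_fin_two]

/-- Integral powers of a scalar multiple of an element of a one-parameter group of matrices. -/
theorem map_zpow_eq_smul {G : Type*} [Group G] (F : G →* Matrix (Fin 2) (Fin 2) ℂ)
    (E : ℂ → Matrix (Fin 2) (Fin 2) ℂ) (hE0 : E 0 = 1) (hE : ∀ t u, E t * E u = E (t + u))
    {g : G} {s t : ℂ} (hs : s ≠ 0) (hg : F g = s • E t) (k : ℤ) :
    F (g ^ k) = s ^ k • E (k * t) := by
  have hinv : F g⁻¹ = s⁻¹ • E (-t) := by
    have h1 : F g * (s⁻¹ • E (-t)) = 1 := by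
      rw [hg, smul_mul_smul_comm, hE, mul_inv_cancel₀ hs, add_neg_cancel, hE0, one_smul]
    have h2 : F g⁻¹ * F g = 1 := by rw [← map_mul, inv_mul_cancel, map_one]
    exact left_inv_eq_right_inv h2 h1
  induction k with
  | zero => simp [hE0]
  | succ k ih =>
    rw [zpow_add_one, map_mul, ih, hg, smul_mul_smul_comm, hE, zpow_add_one₀ hs]
    push_cast
    ring_nf
  | pred k ih =>
    rw [zpow_sub_one, map_mul, ih, hinv, smul_mul_smul_comm, hE, zpow_sub_one₀ hs]
    push_cast
    ring_nf

/-! ### Normal form of a pair of parabolic matrices -/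

/-- The basis consists of v = (sA - 1)u and u, where u is an eigenvector of B: it makes A upper and
B lower triangular, and this v normalises the corner entry of A to s. -/
theorem exists_conj_eq_unipotent {A B : Matrix (Fin 2) (Fin 2) ℂ} {s : ℂ} (hs : s * s = 1)
    (hA : A.det = 1) (hB : B.det = 1) (htA : A.trace = 2 * s) (htB : B.trace = 2 * s)
    (h : ∀ u : Fin 2 → ℂ, u ≠ 0 → A *ᵥ u = s • u → B *ᵥ u ≠ s • u) :
    ∃ (P : Matrix (Fin 2) (Fin 2) ℂ) (z : ℂ), IsUnit P.det ∧
      P⁻¹ * A * P = s • upperUnipotent 1 ∧ P⁻¹ * B * P = s • lowerUnipotent z := by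
  have hdet : (B - s • (1 : Matrix (Fin 2) (Fin 2) ℂ)).det = 0 := by
    rw [Matrix.det_fin_two] at hB ⊢
    rw [Matrix.trace_fin_two] at htB
    simp
    linear_combination hB + (-s) * htB - hs
  obtain ⟨u, hu, hBu⟩ := Matrix.exists_mulVec_eq_zero_iff.mpr hdet
  have hBu' : B *ᵥ u = s • u := by
    rw [Matrix.sub_mulVec, sub_eq_zero] at hBu
    simpa [Matrix.smul_mulVec] using hBu
  have hAu : A *ᵥ u ≠ s • u := fun hh => h u hu hh hBu'
  set v : Fin 2 → ℂ := s • (A *ᵥ u) - u with hv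
  have hAu' : A *ᵥ u = s • (v + u) := by
    rw [hv, sub_add_cancel, smul_smul, hs, one_smul]
  -- Cayley–Hamilton: trace 2s and determinant 1 = s² give (A - s)² = 0.
  have hAv : A *ᵥ v = s • v := by
    rw [Matrix.det_fin_two] at hA
    rw [Matrix.trace_fin_two] at htA
    rw [hv]
    ext i
    fin_cases i
    · simp [Matrix.mulVec, dotProduct, Fin.sum_univ_two, Matrix.vecHead, Matrix.vecTail]
      linear_combination (-s * u 0) * hA + (s * (A 0 0 * u 0 + A 0 1 * u 1)) * htA +
        (A 0 0 * u 0 + A 0 1 * u 1) * hs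
    · simp [Matrix.mulVec, dotProduct, Fin.sum_univ_two, Matrix.vecHead, Matrix.vecTail]
      linear_combination (-s * u 1) * hA + (s * (A 1 0 * u 0 + A 1 1 * u 1)) * htA +
        (A 1 0 * u 0 + A 1 1 * u 1) * hs
  have hs0 : s ≠ 0 := left_ne_zero_of_mul_eq_one hs
  have hPdet : v 0 * u 1 - u 0 * v 1 ≠ 0 := by
    intro h0
    have hpar : ∃ k : ℂ, v = k • u := by
      by_cases hu0 : u 0 = 0
      · have hu1 : u 1 ≠ 0 := fun hu1 => hu (by ext i; fin_cases i <;> simp [hu0, hu1])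
        refine ⟨v 1 / u 1, ?_⟩
        ext i; fin_cases i
        · simpa [hu0, hu1] using h0
        · simp [hu1]
      · refine ⟨v 0 / u 0, ?_⟩
        ext i; fin_cases i
        · simp [hu0]
        · simp; field_simp; linear_combination -h0
    obtain ⟨k, hk⟩ := hpar
    have hkk : k • v = 0 := by
      have h1 := hAv
      rw [hk, Matrix.mulVec_smul, hAu', ← hk, smul_comm, smul_add, ← hk] at h1
      have h2 := smul_right_injective _ hs0 h1
      simpa using h2
    have hv0 : v = 0 := by
      rcases smul_eq_zero.mp hkk with h1 | h1
      · rw [hk, h1, zero_smul]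
      · exact h1
    exact hAu (by rw [hAu', hv0, zero_add])
  set P : Matrix (Fin 2) (Fin 2) ℂ := !![v 0, u 0; v 1, u 1] with hP
  have hPu : IsUnit P.det := by
    rw [hP, Matrix.det_fin_two_of]
    exact hPdet.isUnit
  have hAP : A * P = P * (s • upperUnipotent 1) := by
    have e1 := fun i => congrFun hAu' i
    have e2 := fun i => congrFun hAv i
    simp only [Matrix.mulVec, dotProduct, Fin.sum_univ_two, Pi.smul_apply, Pi.add_apply,
      smul_eq_mul] at e1 e2
    ext i j
    fin_cases i <;> fin_cases j <;>
      simp [hP, upperUnipotent, Matrix.mul_apply, Fin.sum_univ_two, e1, e2] <;> ring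
  -- The second basis vector is the eigenvector u of B; the trace then determines the upper left
  -- entry.
  have hQ1 : ∀ i, (P⁻¹ * B * P) i 1 = (s • (1 : Matrix (Fin 2) (Fin 2) ℂ)) i 1 := by
    intro i
    have e0 : ∀ i, (B * P) i 1 = (s • P) i 1 := by
      intro i
      have e1 := congrFun hBu' i
      simp only [Matrix.mulVec, dotProduct, Fin.sum_univ_two, Pi.smul_apply, smul_eq_mul] at e1
      fin_cases i <;> simpa [hP, Matrix.mul_apply, Fin.sum_univ_two] using e1
    have e2 : (P⁻¹ * B * P) i 1 = (P⁻¹ * (s • P)) i 1 := by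
      rw [Matrix.mul_assoc, Matrix.mul_apply, Matrix.mul_apply]
      exact Finset.sum_congr rfl fun j _ => by rw [e0]
    rw [e2, Matrix.mul_smul, Matrix.nonsing_inv_mul _ hPu]
  have htr : (P⁻¹ * B * P).trace = 2 * s := by
    rw [Matrix.trace_mul_comm, ← Matrix.mul_assoc, Matrix.mul_nonsing_inv _ hPu, Matrix.one_mul,
      htB]
  refine ⟨P, s * (P⁻¹ * B * P) 1 0, hPu, ?_, ?_⟩
  · rw [Matrix.mul_assoc, hAP, ← Matrix.mul_assoc, Matrix.nonsing_inv_mul _ hPu, Matrix.one_mul]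
  · have q01 := hQ1 0
    have q11 := hQ1 1
    rw [Matrix.trace_fin_two] at htr
    simp at q01 q11
    rw [q11] at htr
    ext i j
    fin_cases i <;> fin_cases j
    · simp [lowerUnipotent]; linear_combination htr
    · simpa [lowerUnipotent] using q01
    · simp [lowerUnipotent, ← mul_assoc, hs]
    · simpa [lowerUnipotent] using q11

/-! ### Alternating words in two unipotent matrices -/

/-- The `k`-th letter of an alternating word in a lower and an upper unipotent matrix, with
exponents `ε`. -/
def alternatingLetter (ε : ℕ → ℤˣ) (z : ℂ) (k : ℕ) : Matrix (Fin 2) (Fin 2) ℂ :=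
  if Even k then lowerUnipotent ((ε k : ℤ) * z) else upperUnipotent (ε k : ℤ)

/-- The entries of an alternating word are integral polynomials in `z`, and the lower right one
has leading coefficient `±1`. -/
theorem exists_polynomial_alternating_prod (ε : ℕ → ℤˣ) (z : ℂ) (n : ℕ) :
    ∃ a b c d : ℤ[X], ((List.range (2 * n)).map (alternatingLetter ε z)).prod =
        !![aeval z a, aeval z b; aeval z c, aeval z d] ∧
      c.natDegree ≤ n ∧ d.natDegree ≤ n ∧ IsUnit (d.coeff n) := by
  induction n with
  | zero => exact ⟨1, 0, 0, 1, by simp [Matrix.one_fin_two], by simp, by simp, by simp⟩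
  | succ n ih =>
    obtain ⟨a, b, c, d, h, hc, hd, hu⟩ := ih
    set e : ℤ := (ε (2 * n) : ℤ) with he
    set f : ℤ := (ε (2 * n + 1) : ℤ) with hf
    -- The entries after right multiplication by L(ez) U(f).
    refine ⟨a + C e * (b * X), C f * a + (b + C (e * f) * (b * X)), c + C e * (d * X),
      C f * c + (d + C (e * f) * (d * X)), ?_, ?_, ?_, ?_⟩
    · rw [show 2 * (n + 1) = 2 * n + 1 + 1 by ring, List.range_succ, List.range_succ]
      simp only [List.map_append, List.prod_append, h, List.map_cons, List.map_nil,
        List.prod_cons, List.prod_nil, mul_one]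
      have h1 : alternatingLetter ε z (2 * n) = lowerUnipotent (e * z) := by
        simp [alternatingLetter, he]
      have h2 : alternatingLetter ε z (2 * n + 1) = upperUnipotent f := by
        simp [alternatingLetter, hf]
      rw [h1, h2]
      ext i j
      fin_cases i <;> fin_cases j <;>
        simp [lowerUnipotent, upperUnipotent] <;> ring
    · refine (natDegree_add_le _ _).trans (max_le (by omega) ?_)
      exact (natDegree_C_mul_le _ _).trans (natDegree_mul_le.trans (by simp; omega))
    · refine (natDegree_add_le _ _).trans (max_le ((natDegree_C_mul_le _ _).trans (by omega)) ?_)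
      refine (natDegree_add_le _ _).trans (max_le (by omega) ?_)
      exact (natDegree_C_mul_le _ _).trans (natDegree_mul_le.trans (by simp; omega))
    -- Only the term ef · dX reaches degree n + 1, so the top coefficient is multiplied by ef = ±1.
    · have h1 : c.coeff (n + 1) = 0 := coeff_eq_zero_of_natDegree_lt (by omega)
      have h2 : d.coeff (n + 1) = 0 := coeff_eq_zero_of_natDegree_lt (by omega)
      simp only [coeff_add, coeff_C_mul, coeff_mul_X, h1, h2, mul_zero, zero_add]
      exact ((Units.isUnit _).mul (Units.isUnit _)).mul hu

theorem isIntegral_of_aeval_eq_zero_of_isUnit_coeff {z : ℂ} {d : ℤ[X]} {n : ℕ}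
    (hd : d.natDegree ≤ n) (hu : IsUnit (d.coeff n)) (h : aeval z d = 0) : IsIntegral ℤ z := by
  have hn : d.natDegree = n := le_antisymm hd (le_natDegree_of_ne_zero hu.ne_zero)
  rcases Int.isUnit_iff.mp hu with h1 | h1
  · exact ⟨d, by rw [Monic, leadingCoeff, hn, h1], h⟩
  · exact ⟨-d, by rw [Monic, leadingCoeff_neg, leadingCoeff, hn, h1, neg_neg], by
      rw [← aeval_def, map_neg, h, neg_zero]⟩

theorem alternatingLetter_flip (ε : ℕ → ℤˣ) (z : ℂ) (k : ℕ) :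
    !![0, 1; 1, 0] * (alternatingLetter ε z k)ᵀ * !![0, 1; 1, 0] = alternatingLetter ε z k := by
  unfold alternatingLetter
  split_ifs <;> ext i j <;> fin_cases i <;> fin_cases j <;>
    simp only [Matrix.mul_apply, Fin.sum_univ_two, Matrix.transpose_apply] <;>
    simp [lowerUnipotent, upperUnipotent]

/-- Reversing an alternating word reflects the matrix in the antidiagonal. -/
theorem alternating_prod_reverse (ε : ℕ → ℤˣ) (z : ℂ) (l : List ℕ) :
    (l.reverse.map (alternatingLetter ε z)).prod =
      !![0, 1; 1, 0] * ((l.map (alternatingLetter ε z)).prod)ᵀ * !![0, 1; 1, 0] := by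
  have hJ : (!![0, 1; 1, 0] : Matrix (Fin 2) (Fin 2) ℂ) * !![0, 1; 1, 0] = 1 := by
    simp [Matrix.one_fin_two]
  induction l with
  | nil => simp [hJ]
  | cons k l ih =>
    rw [List.reverse_cons, List.map_append, List.prod_append, ih]
    simp only [List.map_cons, List.map_nil, List.prod_cons, List.prod_nil, mul_one,
      Matrix.transpose_mul]
    -- Each letter is fixed by reflection in the antidiagonal, so the inner pair of flips cancels.
    nth_rw 1 [← alternatingLetter_flip ε z k]
    rw [show ∀ J W V : Matrix (Fin 2) (Fin 2) ℂ, J * W * J * (J * V * J) = J * W * (J * J) * V * J by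
      intros; simp only [mul_assoc], hJ, mul_one, mul_assoc _ (_)ᵀ (_)ᵀ]

/-! ### The knot group of a two-bridge knot -/

/-- Every knot group is generated by the meridians of the arcs that occur as over-arcs, together
with the base meridian. -/
theorem KnotDiagram.closure_eq_top (D : KnotDiagram) (S : Set D.KnotGroup)
    (h0 : D.meridian ∈ S) (hS : ∀ i, D.arc (D.overArc i) ∈ S) : Subgroup.closure S = ⊤ := by
  have hp : ∀ j, D.passage j ∈ Subgroup.closure S := fun j =>
    Subgroup.zpow_mem _ (Subgroup.subset_closure (hS _)) _
  have ha : ∀ j, D.arc (D.idx j) ∈ Subgroup.closure S := by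
    intro j
    induction j with
    | zero => exact Subgroup.subset_closure h0
    | succ j ih =>
      rw [D.arc_succ]
      exact mul_mem (mul_mem (inv_mem (hp j)) ih) (hp j)
  rw [eq_top_iff, ← PresentedGroup.closure_range_of D.relators, Subgroup.closure_le]
  rintro _ ⟨i, rfl⟩
  have h := ha i
  rwa [show D.idx i = i from Fin.ext (Nat.mod_eq_of_lt i.2)] at h

/-- An irreducible representation has no eigenvector common to a set of generators. -/
theorem IsIrreducibleRep.not_common_eigenvector {Γ : Type} [Group Γ] {ρ : Γ →* SL2C}
    (hρ : IsIrreducibleRep ρ) {S : Set Γ} (hS : Subgroup.closure S = ⊤) {s : ℂ}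
    {u : Fin 2 → ℂ} (hu : u ≠ 0) :
    ¬ ∀ g ∈ S, (ρ g : Matrix (Fin 2) (Fin 2) ℂ) *ᵥ u = s • u := by
  intro h
  have hall : ∀ g : Γ, ∃ k : ℂ, (ρ g : Matrix (Fin 2) (Fin 2) ℂ) *ᵥ u = k • u := by
    intro g
    have hg : g ∈ Subgroup.closure S := hS ▸ Subgroup.mem_top g
    induction hg using Subgroup.closure_induction with
    | mem g hg => exact ⟨s, h g hg⟩
    | one => exact ⟨1, by simp⟩
    | mul g g' _ _ ih ih' =>
      obtain ⟨k, hk⟩ := ih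
      obtain ⟨k', hk'⟩ := ih'
      refine ⟨k' * k, ?_⟩
      rw [map_mul, Matrix.SpecialLinearGroup.coe_mul, ← Matrix.mulVec_mulVec, hk',
        Matrix.mulVec_smul, hk, smul_smul]
    | inv g _ ih =>
      obtain ⟨k, hk⟩ := ih
      have h1 : u = k • ((ρ g⁻¹ : Matrix (Fin 2) (Fin 2) ℂ) *ᵥ u) := by
        rw [← Matrix.mulVec_smul, ← hk, Matrix.mulVec_mulVec,
          ← Matrix.SpecialLinearGroup.coe_mul, ← map_mul, inv_mul_cancel, map_one,
          Matrix.SpecialLinearGroup.coe_one, Matrix.one_mulVec]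
      have hk0 : k ≠ 0 := by
        rintro rfl
        exact hu (by rw [h1, zero_smul])
      refine ⟨k⁻¹, ?_⟩
      conv_rhs => rw [h1]
      rw [inv_smul_smul₀ hk0]
  have hs : IsSimpleOrder (Subrepresentation (linearRep ρ)) := hρ
  let L : Subrepresentation (linearRep ρ) :=
    { toSubmodule := Submodule.span ℂ {u}
      apply_mem_toSubmodule := by
        intro g v hv
        obtain ⟨c, rfl⟩ := Submodule.mem_span_singleton.mp hv
        obtain ⟨k, hk⟩ := hall g
        refine Submodule.mem_span_singleton.mpr ⟨c * k, ?_⟩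
        change _ = Matrix.toLin' (ρ g : Matrix (Fin 2) (Fin 2) ℂ) (c • u)
        rw [Matrix.toLin'_apply, Matrix.mulVec_smul, hk, smul_smul] }
  -- An invariant line in ℂ² is neither zero nor the whole space.
  have hfr : Module.finrank ℂ L.toSubmodule = 1 := finrank_span_singleton hu
  rcases hs.eq_bot_or_eq_top L with h1 | h1
  · rw [h1] at hfr
    have h2 : Module.finrank ℂ (⊥ : Submodule ℂ (Fin 2 → ℂ)) = 1 := hfr
    simp at h2
  · rw [h1] at hfr
    have h2 : Module.finrank ℂ (⊤ : Submodule ℂ (Fin 2 → ℂ)) = 1 := hfr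
    simp at h2

/-- The signs of an underpass of Schubert's normal form are palindromic. -/
theorem twoBridgeSign_sub {α : ℕ} {β : ℤ} (hα : 1 < α) (hβ : Odd β)
    (hαβ : IsCoprime (α : ℤ) β) {k : ℕ} (hk0 : 0 < k) (hk : k < α) :
    twoBridgeSign α β (α - k) = twoBridgeSign α β k := by
  have hα0 : (0 : ℤ) < α := by omega
  have hnd : ¬ (α : ℤ) ∣ k * β := by
    intro h
    have h1 : α ∣ k := Int.natCast_dvd_natCast.mp (hαβ.dvd_of_dvd_mul_right h)
    exact absurd (Nat.le_of_dvd hk0 h1) (by omega)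
  -- The -1 appears because kβ/α is not an integer; as β is odd, β - 1 does not affect the sign.
  have hdiv : (((α - k : ℕ) : ℤ) * β) / α = β - 1 - (k * β) / α := by
    have hm := Int.mul_ediv_add_emod (k * β : ℤ) α
    have hm0 : 0 < (k * β : ℤ) % α :=
      lt_of_le_of_ne (Int.emod_nonneg _ hα0.ne') fun h => hnd (Int.dvd_of_emod_eq_zero h.symm)
    have hm1 := Int.emod_lt_of_pos (k * β : ℤ) hα0
    rw [Int.ediv_eq_iff_of_pos hα0]
    push_cast [hk.le]
    constructor <;> nlinarith
  unfold twoBridgeSign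
  rw [hdiv]
  obtain ⟨b, rfl⟩ := hβ
  rw [show 2 * b + 1 - 1 - (k * (2 * b + 1) : ℤ) / α = 2 * b + -((k * (2 * b + 1) : ℤ) / α) by ring,
    zpow_add, zpow_mul, zpow_neg]
  simp

/-- The bridge `x` of Schubert's normal form. -/
def bridgeX (α : ℕ) (β : ℤ) (hα : 1 < α) : (twoBridgeKnot α β hα).KnotGroup :=
  (twoBridgeKnot α β hα).meridian

/-- The bridge `y` of Schubert's normal form. -/
def bridgeY (α : ℕ) (β : ℤ) (hα : 1 < α) : (twoBridgeKnot α β hα).KnotGroup :=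
  (twoBridgeKnot α β hα).arc ((twoBridgeKnot α β hα).idx (α - 1))

theorem twoBridgeKnot_passage {α : ℕ} {β : ℤ} (hα : 1 < α) {k : ℕ} (hk : k < 2 * (α - 1)) :
    (twoBridgeKnot α β hα).passage k =
      (if (k < α - 1 ↔ Even k) then bridgeY α β hα else bridgeX α β hα) ^
        (twoBridgeSign α β (k % (α - 1) + 1) : ℤ) := by
  have hmod : k % (2 * (α - 1)) = k := Nat.mod_eq_of_lt hk
  have hmod' : (α - 1) % (2 * (α - 1)) = α - 1 := Nat.mod_eq_of_lt (by omega)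
  unfold KnotDiagram.passage bridgeX bridgeY KnotDiagram.meridian
  simp only [twoBridgeKnot, KnotDiagram.idx, hmod, hmod', Nat.zero_mod]
  split_ifs <;> rfl

theorem closure_bridges {α : ℕ} {β : ℤ} (hα : 1 < α) :
    Subgroup.closure {bridgeX α β hα, bridgeY α β hα} = ⊤ := by
  refine KnotDiagram.closure_eq_top _ _ (Or.inl rfl) fun i => ?_
  have hmod' : (α - 1) % (2 * (α - 1)) = α - 1 := Nat.mod_eq_of_lt (by omega)
  unfold bridgeX bridgeY KnotDiagram.meridian
  simp only [twoBridgeKnot, KnotDiagram.idx, hmod', Nat.zero_mod]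
  split_ifs
  · exact Or.inr rfl
  · exact Or.inl rfl

theorem twoBridgeKnot_writhe {α : ℕ} {β : ℤ} (hα : 1 < α) :
    (twoBridgeKnot α β hα).writhe =
      2 * ∑ k ∈ Finset.range (α - 1), (twoBridgeSign α β (k + 1) : ℤ) := by
  have h : (twoBridgeKnot α β hα).writhe = ∑ k ∈ Finset.range (2 * (α - 1)),
      (twoBridgeSign α β (k % (α - 1) + 1) : ℤ) :=
    Fin.sum_univ_eq_sum_range (fun k => (twoBridgeSign α β (k % (α - 1) + 1) : ℤ)) (2 * (α - 1))
  rw [h, two_mul (α - 1), Finset.sum_range_add, two_mul]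
  congr 1
  · refine Finset.sum_congr rfl fun k hk => ?_
    rw [Nat.mod_eq_of_lt (Finset.mem_range.mp hk)]
  · refine Finset.sum_congr rfl fun k hk => ?_
    rw [Nat.add_mod_left, Nat.mod_eq_of_lt (Finset.mem_range.mp hk)]

/-! ### The longitude under a parabolic representation -/

theorem prod_map_smul_range (s : ℂ) (m : ℕ → Matrix (Fin 2) (Fin 2) ℂ) (n : ℕ) :
    ((List.range n).map fun k => s • m k).prod = s ^ n • ((List.range n).map m).prod := by
  induction n with
  | zero => simp
  | succ n ih =>
    simp only [List.range_succ, List.map_append, List.prod_append, List.map_cons, List.map_nil,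
      List.prod_cons, List.prod_nil, mul_one, ih, smul_mul_smul_comm, pow_succ]

/-- A parabolic representation of the group of a two-bridge knot, in normal form, sends the
preferred longitude to minus a unipotent matrix whose off-diagonal entry is twice an algebraic
integer. -/
theorem map_longitude_eq {α : ℕ} {β : ℤ} (hα : 1 < α) (hα_odd : Odd α) (hβ_odd : Odd β)
    (hαβ : IsCoprime (α : ℤ) β)
    (F : (twoBridgeKnot α β hα).KnotGroup →* Matrix (Fin 2) (Fin 2) ℂ) {s z : ℂ}
    (hs : s * s = 1) (hx : F (bridgeX α β hα) = s • upperUnipotent 1)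
    (hy : F (bridgeY α β hα) = s • lowerUnipotent z) :
    ∃ g : ℂ, IsIntegral ℤ g ∧
      F (twoBridgeKnot α β hα).longitude = (-1 : ℂ) • upperUnipotent (2 * g) := by
  obtain ⟨n, hn⟩ : ∃ n, α - 1 = 2 * n := by
    obtain ⟨n, rfl⟩ := hα_odd
    exact ⟨n, by omega⟩
  have hs0 : s ≠ 0 := left_ne_zero_of_mul_eq_one hs
  have hs2 : ∀ k : ℤ, s ^ (2 * k) = 1 := fun k => by
    rw [zpow_mul, zpow_ofNat, pow_two, hs, one_zpow]
  have hsu : ∀ e : ℤˣ, s ^ (e : ℤ) = s := fun e => by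
    rcases Int.units_eq_one_or e with rfl | rfl
    · simp
    · simpa using inv_eq_of_mul_eq_one_left hs
  set ε : ℕ → ℤˣ := fun k => twoBridgeSign α β (k + 1) with hε
  have hxk := fun k => map_zpow_eq_smul F _ upperUnipotent_zero upperUnipotent_mul hs0 hx k
  have hyk := fun k => map_zpow_eq_smul F _ lowerUnipotent_zero lowerUnipotent_mul hs0 hy k
  have hfirst : ∀ k < 2 * n, F ((twoBridgeKnot α β hα).passage k) =
      s • alternatingLetter ε z k := by
    intro k hk
    rw [twoBridgeKnot_passage hα (by omega), Nat.mod_eq_of_lt (by omega)]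
    by_cases he : Even k
    · rw [if_pos (by simp only [he, iff_true]; omega), hyk, hsu, alternatingLetter, if_pos he]
    · rw [if_neg (by simp only [he, iff_false]; omega), hxk, hsu, alternatingLetter, if_neg he,
        mul_one]
  -- The second underpass is the first read backwards: the palindrome matches the signs, and k ↦ 2n
  -- - 1 - k changes parity, which accounts for the exchange of x and y.
  have hsecond : ∀ k < 2 * n, F ((twoBridgeKnot α β hα).passage (2 * n + k)) =
      s • alternatingLetter ε z (2 * n - 1 - k) := by
    intro k hk
    have hεk : twoBridgeSign α β (k + 1) = ε (2 * n - 1 - k) := by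
      rw [← twoBridgeSign_sub hα hβ_odd hαβ (by omega) (by omega)]
      simp only [hε]
      congr 1
      omega
    have hmod : (2 * n + k) % (α - 1) = k := by
      rw [hn, Nat.add_mod_left, Nat.mod_eq_of_lt hk]
    have hlt : ¬ 2 * n + k < α - 1 := by omega
    rw [twoBridgeKnot_passage hα (by omega), hmod, hεk]
    by_cases he : Even k
    · have he' : ¬ Even (2 * n - 1 - k) := by rw [Nat.even_iff] at he ⊢; omega
      have he2 : Even (2 * n + k) := by rw [Nat.even_iff] at he ⊢; omega
      rw [if_neg (by tauto), hxk, hsu, alternatingLetter, if_neg he', mul_one]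
    · have he' : Even (2 * n - 1 - k) := by rw [Nat.even_iff] at he ⊢; omega
      have he2 : ¬ Even (2 * n + k) := by rw [Nat.even_iff] at he ⊢; omega
      rw [if_pos (by tauto), hyk, hsu, alternatingLetter, if_pos he']
  -- Each underpass has an even number of letters, so the factors s cancel.
  have hspow : s ^ (2 * n) = 1 := by rw [pow_mul, pow_two, hs, one_pow]
  obtain ⟨a, b, c, d, hw, -, hd, hu⟩ := exists_polynomial_alternating_prod ε z n
  have hFw : F ((List.range (2 * n)).map (twoBridgeKnot α β hα).passage).prod =
      !![aeval z a, aeval z b; aeval z c, aeval z d] := by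
    rw [map_list_prod, List.map_map, ← hw,
      ← one_smul ℂ (List.prod (List.map (alternatingLetter ε z) _)), ← hspow,
      ← prod_map_smul_range]
    congr 1
    exact List.map_congr_left fun k hk => hfirst k (List.mem_range.mp hk)
  have hFw' : F ((List.range (2 * n)).map
      fun k => (twoBridgeKnot α β hα).passage (2 * n + k)).prod =
      !![aeval z d, aeval z b; aeval z c, aeval z a] := by
    have hrev : (List.range (2 * n)).map (fun k => alternatingLetter ε z (2 * n - 1 - k)) =
        (List.range (2 * n)).reverse.map (alternatingLetter ε z) := by
      rw [List.range_eq_range', List.reverse_range', List.map_map, ← List.range_eq_range']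
      exact List.map_congr_left fun k _ => by simp
    have hprod : F ((List.range (2 * n)).map
        fun k => (twoBridgeKnot α β hα).passage (2 * n + k)).prod =
        ((List.range (2 * n)).map (fun k => alternatingLetter ε z (2 * n - 1 - k))).prod := by
      rw [map_list_prod, List.map_map, ← one_smul ℂ (List.prod (List.map (fun k =>
        alternatingLetter ε z (2 * n - 1 - k)) _)), ← hspow, ← prod_map_smul_range]
      congr 1
      exact List.map_congr_left fun k hk => hsecond k (List.mem_range.mp hk)
    rw [hprod, hrev, alternating_prod_reverse, hw]
    ext i j
    fin_cases i <;> fin_cases j <;>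
      simp only [Matrix.mul_apply, Fin.sum_univ_two, Matrix.transpose_apply] <;> simp
  have hrel : F ((List.range (2 * n)).map (twoBridgeKnot α β hα).passage).prod *
      F (bridgeY α β hα) = F (bridgeX α β hα) *
        F ((List.range (2 * n)).map (twoBridgeKnot α β hα).passage).prod := by
    rw [← map_mul, ← map_mul]
    congr 1
    have := (twoBridgeKnot α β hα).arc_eq (2 * n)
    rwa [bridgeY, bridgeX, hn]
  have hdet : aeval z a * aeval z d - aeval z b * aeval z c = (1 : ℂ) := by
    have h1 : ∀ l : List ℕ, ((l.map (alternatingLetter ε z)).prod).det = 1 := by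
      intro l
      induction l with
      | nil => simp
      | cons k l ih =>
        rw [List.map_cons, List.prod_cons, Matrix.det_mul, ih, mul_one, alternatingLetter]
        split_ifs <;> simp [lowerUnipotent, upperUnipotent]
    rw [← h1 (List.range (2 * n)), hw, Matrix.det_fin_two_of]
  -- Compare the upper right entries of WY and XW, which are sb and s(b + d).
  have hd0 : aeval z d = 0 := by
    rw [hFw, hx, hy] at hrel
    have h01 := congrFun (congrFun hrel 0) 1
    simp [lowerUnipotent, upperUnipotent] at h01
    have h2 : s * aeval z d = 0 := by linear_combination -h01
    exact (mul_eq_zero.mp h2).resolve_left hs0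
  have hz : IsIntegral ℤ z := isIntegral_of_aeval_eq_zero_of_isUnit_coeff hd hu hd0
  have hpar : F (twoBridgeKnot α β hα).parallel =
      (-1 : ℂ) • upperUnipotent (-2 * (aeval z a * aeval z b)) := by
    have hsplit : (twoBridgeKnot α β hα).parallel =
        ((List.range (2 * n)).map (twoBridgeKnot α β hα).passage).prod *
        ((List.range (2 * n)).map fun k => (twoBridgeKnot α β hα).passage (2 * n + k)).prod := by
      have hc : (twoBridgeKnot α β hα).crossings = 2 * n + 2 * n := by
        change 2 * (α - 1) = _
        omega
      have hr : List.range (twoBridgeKnot α β hα).crossings =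
          List.range (2 * n) ++ (List.range (2 * n)).map (2 * n + ·) :=
        (congrArg List.range hc).trans List.range_add
      rw [KnotDiagram.parallel, hr, List.map_append, List.prod_append, List.map_map]
      rfl
    rw [hsplit, map_mul, hFw, hFw']
    -- Now bc = -1; this is where the sign -1 of the longitude comes from.
    rw [hd0, mul_zero, zero_sub] at hdet
    ext i j
    fin_cases i <;> fin_cases j <;> simp [upperUnipotent, hd0]
    · linear_combination -hdet
    · ring
    · linear_combination -hdet
  set σ : ℤ := ∑ k ∈ Finset.range (α - 1), (twoBridgeSign α β (k + 1) : ℤ) with hσ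
  have hpoly : ∀ f : ℤ[X], IsIntegral ℤ (aeval z f) := fun f =>
    adjoin_le_integralClosure hz (Polynomial.aeval_mem_adjoin_singleton (p := f) ℤ z)
  refine ⟨-(σ + aeval z a * aeval z b), ?_, ?_⟩
  · exact ((isIntegral_algebraMap (R := ℤ) (A := ℂ) (x := σ)).add
      ((hpoly a).mul (hpoly b))).neg
  -- The writhe is 2σ, so s drops out and the correction to the off-diagonal entry is also even.
  · have hm : F ((twoBridgeKnot α β hα).meridian ^ (-(twoBridgeKnot α β hα).writhe)) =
        upperUnipotent (-2 * σ) := by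
      have h1 := hxk (-(twoBridgeKnot α β hα).writhe)
      rw [twoBridgeKnot_writhe, ← hσ, ← mul_neg, hs2, one_smul, mul_one] at h1
      rw [twoBridgeKnot_writhe, ← hσ, ← mul_neg]
      refine h1.trans ?_
      congr 1
      push_cast
      ring
    rw [KnotDiagram.longitude, map_mul, hm, hpar, mul_smul_comm, upperUnipotent_mul]
    congr 2
    ring

/-! ### Arithmetic of slopes and conclusion -/

theorem smul_upperUnipotent_mul_ne_one {p q : ℤ} (hpq : IsCoprime p q) {s g : ℂ} (hs : s * s = 1)
    (hg : IsIntegral ℤ g) :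
    s ^ p • upperUnipotent p * (-1 : ℂ) ^ q • upperUnipotent (q * (2 * g)) ≠ 1 := by
  intro h
  rw [smul_mul_smul_comm, upperUnipotent_mul] at h
  have h00 : s ^ p * (-1 : ℂ) ^ q = 1 := by
    simpa [upperUnipotent] using congrFun (congrFun h 0) 0
  have h01 : (p : ℂ) + q * (2 * g) = 0 := by
    have h1 := congrFun (congrFun h 0) 1
    rw [h00, one_smul] at h1
    simpa [upperUnipotent] using h1
  -- For q ≠ 0, g = -p/(2q) is a rational algebraic integer, so m = -g works; for q = 0 also p = 0.
  obtain ⟨m, hm⟩ : ∃ m : ℤ, p = 2 * (q * m) := by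
    by_cases hq : q = 0
    · subst hq
      exact ⟨0, by simpa using h01⟩
    · have hq' : (q : ℂ) ≠ 0 := by exact_mod_cast hq
      have hgr : algebraMap ℚ ℂ (-p / (2 * q)) = g := by
        simp
        field_simp
        linear_combination -h01
      rw [← hgr, isIntegral_algebraMap_iff (algebraMap ℚ ℂ).injective,
        IsIntegrallyClosed.isIntegral_iff] at hg
      obtain ⟨m, hm⟩ := hg
      refine ⟨-m, ?_⟩
      have : (q : ℚ) ≠ 0 := by exact_mod_cast hq
      have h2 : (m : ℚ) = -p / (2 * q) := hm
      field_simp at h2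
      have h3 : m * 2 * q = -p := by exact_mod_cast h2
      linear_combination h3
  -- As q divides p, q = ±1; p is even, so the scalar s^p (-1)^q is -1.
  have hqu : IsUnit q := hpq.isUnit_of_dvd' (hm ▸ ⟨2 * m, by ring⟩) dvd_rfl
  rw [hm, zpow_mul, zpow_ofNat, pow_two, hs, one_zpow, one_mul] at h00
  rcases Int.isUnit_iff.mp hqu with rfl | rfl <;> norm_num at h00

theorem twoBridgeKnot_slope_ne_one (α : ℕ) (β : ℤ) (hα : 1 < α) (hα_odd : Odd α) (hβ_odd : Odd β)
    (hαβ : IsCoprime (α : ℤ) β) (p q : ℤ) (hpq : IsCoprime p q)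
    (ρ : (twoBridgeKnot α β hα).KnotGroup →* SL2C) (hρ : IsIrreducibleRep ρ)
    (htr : character ρ (twoBridgeKnot α β hα).meridian = 2 ∨
      character ρ (twoBridgeKnot α β hα).meridian = -2) :
    ρ ((twoBridgeKnot α β hα).meridian ^ p * (twoBridgeKnot α β hα).longitude ^ q) ≠ 1 := by
  obtain ⟨s, hs, htx⟩ : ∃ s : ℂ, s * s = 1 ∧ character ρ (bridgeX α β hα) = 2 * s := by
    rcases htr with h | h
    · exact ⟨1, by norm_num, by rw [mul_one]; exact h⟩
    · exact ⟨-1, by norm_num, by rw [mul_neg_one]; exact h⟩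
  have hty : character ρ (bridgeY α β hα) = 2 * s := by
    rw [← htx]
    have h := (twoBridgeKnot α β hα).arc_eq (α - 1)
    have h2 : bridgeY α β hα = (((List.range (α - 1)).map (twoBridgeKnot α β hα).passage).prod)⁻¹ *
        (bridgeX α β hα * ((List.range (α - 1)).map (twoBridgeKnot α β hα).passage).prod) :=
      eq_inv_mul_of_mul_eq h
    rw [h2, character, character, map_mul, Matrix.SpecialLinearGroup.coe_mul,
      Matrix.trace_mul_comm, ← Matrix.SpecialLinearGroup.coe_mul, ← map_mul]
    group
  obtain ⟨P, z, hP, hA, hB⟩ := exists_conj_eq_unipotent hs (ρ (bridgeX α β hα)).det_coe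
    (ρ (bridgeY α β hα)).det_coe htx hty fun u hu h1 h2 =>
      hρ.not_common_eigenvector (closure_bridges hα) (s := s) hu (by
        rintro g (rfl | rfl)
        · exact h1
        · exact h2)
  let F : (twoBridgeKnot α β hα).KnotGroup →* Matrix (Fin 2) (Fin 2) ℂ :=
    { toFun := fun g => P⁻¹ * (ρ g : Matrix (Fin 2) (Fin 2) ℂ) * P
      map_one' := by simp [Matrix.nonsing_inv_mul _ hP]
      map_mul' := fun g h => by
        rw [map_mul, Matrix.SpecialLinearGroup.coe_mul]
        simp only [Matrix.mul_assoc]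
        rw [Matrix.mul_nonsing_inv_cancel_left _ _ hP] }
  obtain ⟨g, hg, hl⟩ := map_longitude_eq hα hα_odd hβ_odd hαβ F hs hA hB
  intro h
  have hF : F ((twoBridgeKnot α β hα).meridian ^ p * (twoBridgeKnot α β hα).longitude ^ q) = 1 := by
    change P⁻¹ * (ρ _ : Matrix (Fin 2) (Fin 2) ℂ) * P = 1
    rw [h]
    simp [Matrix.nonsing_inv_mul _ hP]
  have hx := map_zpow_eq_smul F _ upperUnipotent_zero upperUnipotent_mul
    (left_ne_zero_of_mul_eq_one hs) hA p
  have hlq := map_zpow_eq_smul F _ upperUnipotent_zero upperUnipotent_mul (by norm_num) hl q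
  rw [mul_one] at hx
  refine smul_upperUnipotent_mul_ne_one hpq hs hg ?_
  rw [← hlq, ← hF, map_mul]
  exact congrArg (· * _) hx.symm

/-- Regularity follows from the second assertion: an irregular slope would supply an irreducible
representation, parabolic or ±I on the meridian, whose kernel on the boundary contains γ. -/
theorem mainTheorem6 (α : ℕ) (β : ℤ) (hα : 1 < α) (hα_odd : Odd α) (hβ_odd : Odd β)
    (hαβ : IsCoprime (α : ℤ) β) (p q : ℤ) (hpq : IsCoprime p q) :
    (twoBridgeKnot α β hα).IsRegularSlope p q ∧
    ∀ ρ : (twoBridgeKnot α β hα).KnotGroup →* SL2C, IsIrreducibleRep ρ →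
      (character ρ (twoBridgeKnot α β hα).meridian = 2 ∨
        character ρ (twoBridgeKnot α β hα).meridian = -2) →
      ρ ((twoBridgeKnot α β hα).meridian ^ p * (twoBridgeKnot α β hα).longitude ^ q) ≠ 1 := by
  refine ⟨?_, twoBridgeKnot_slope_ne_one α β hα hα_odd hβ_odd hαβ p q hpq⟩
  rintro ⟨ρ, hρ, -, htr, hker⟩
  have hμ : (twoBridgeKnot α β hα).peripheral (Multiplicative.ofAdd (1, 0)) =
      (twoBridgeKnot α β hα).meridian := by
    simp [KnotDiagram.peripheral]
  have htμ := htr (Multiplicative.ofAdd (1, 0))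
  rw [hμ] at htμ
  have hmem : Multiplicative.ofAdd (p, q) ∈
      (ρ.comp (twoBridgeKnot α β hα).peripheral).ker := by
    rw [hker]
    exact Subgroup.mem_zpowers _
  exact twoBridgeKnot_slope_ne_one α β hα hα_odd hβ_odd hαβ p q hpq ρ hρ htμ hmem
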